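/- Let $\mathcal N$ be a $W^*$-algebra, $(P_t)_{t\ge 0}$ a Markov semigroup on $\mathcal N$ (completely positive, contractive, unital maps with $P_0=\mathrm{id}$, $P_{s+t}=P_sP_t$, and $P_t(a)\to a$ weak-$*$ as $t\to 0$ for every $a$), and $\tau$ a normal faithful semi-finite trace on $\mathcal N$ that is symmetric: $\tau(a\,P_t(b))=\tau(P_t(a)\,b)$ for $a,b\ge 0$. Let $L^2(\tau)$ be the completion of $\mathfrak n=\{a\in\mathcal N:\tau(a^*a)<\infty\}$ for $\langle a,b\rangle=\tau(a^*b)$, let $(P^{(2)}_t)$ be the extension of $(P_t)$ to $L^2(\tau)$, and let $$\mathcal E[u]=\lim_{t\searrow 0}\tfrac1t\langle u,u-P^{(2)}_tu\rangle=\|\Delta_{(2)}^{1/2}u\|^2\in[0,\infty],\qquad D(\mathcal E)=\{u\in L^2(\tau):\mathcal E[u]<\infty\}$$ be the associated Dirichlet form, where $\Delta_{(2)}\geq 0$ is the generator, $\Delta_{(2)}u=\lim_{t\searrow0}\frac1t(u-P_t^{(2)}u)$; $\mathcal E(\cdot,\cdot)$ denotes the corresponding Hermitian form. Let $\mathcal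 A\subseteq\mathcal N$ be a regular $C^*$-subalgebra: $\tau|_{\mathcal A}$ is norm-semi-finite, $\mathcal A\cap\mathfrak n$ and $\mathcal B:=\mathcal A\cap D(\mathcal E)$ are norm dense in $\mathcal A$, and $\mathcal B$ is dense in $D(\mathcal E)$ for the inner product $\langle a,b\rangle+\mathcal E(a,b)$. Let $(\mathcal H,J,\partial)$ be a symmetric differential calculus associated with $\mathcal E$: $\mathcal H$ is a Hilbert bimodule over $\mathcal A$, $J$ is an antilinear involution of $\mathcal H$ with $J(ahb)=b^*J(h)a^*$, and $\partial:\mathcal B\to\mathcal H$ is linear, closable as an operator from $L^2(\tau)$ to $\mathcal H$, with $\partial(a^*)=J(\partial a)$, $\partial(ab)=(\partial a)b+a\,\partial b$ and $\mathcal E(a,b)=\langle\partial a,\partial b\rangle_{\mathcal H}$ for $a,b\in\mathcal B$ (for example, the gradient operator on the tangent bimodule of $\mathcal E$). Denote also by $\partial:D(\mathcal E)\to\mathcal H$ its closure. **Theorem.** Let $F:\mathcal H\to\mathcal H$ and $\theta>0$ satisfy $$\mathrm{Re}\,\langle F(h)-F(v),h-v\rangle_{\mathcal H}\ \ge\ \theta\,\|h-v\|_{\mathcal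 H}^2\qquad\text{for all }h,v\in\mathcal H,$$ and let $f\in D(\mathcal E)$. Call $u\in D(\mathcal E)$ a weak solution of $\partial^*F(\partial u)=f$ if $\langle F(\partial u),\partial g\rangle_{\mathcal H}=\langle f,g\rangle_{L^2(\tau)}$ for all $g\in D(\mathcal E)$, and call an element of the quotient $D_0(\mathcal E)=D(\mathcal E)/\ker\mathcal E$, $\ker\mathcal E=\{u\in D(\mathcal E):\mathcal E[u]=0\}$, a weak solution if it is the class of a weak solution in $D(\mathcal E)$. Then the equation $\partial^*F(\partial u)=f$ has at most one weak solution in $D_0(\mathcal E)$. -/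

import Mathlib

universe u v

namespace NCDirichlet

open scoped ENNReal NNReal CStarAlgebra ComplexConjugate
open Filter Topology

noncomputable section

set_option linter.unusedSectionVars false

/-! ### The weak-star topology, traces, and the space `L²(τ)` -/

/-- A Banach predual of a `C*`-algebra. -/
structure Predual (N : Type u) [CStarAlgebra N] where
  X : Type u
  [instNorm : NormedAddCommGroup X]
  [instSpace : NormedSpace ℂ X]
  [instComplete : CompleteSpace X]
  equiv : StrongDual ℂ X ≃ₗᵢ⋆[ℂ] N

attribute [instance] Predual.instNorm Predual.instSpace Predual.instComplete

/-- The Banach predual of a `W*`-algebra (it is unique up to isometric isomorphism, and the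
weak-star topology below does not depend on it). -/
def predual (N : Type u) [CStarAlgebra N] [WStarAlgebra N] : Predual N :=
  Classical.choice (by
    obtain ⟨X, i₁, i₂, i₃, ⟨e⟩⟩ := WStarAlgebra.exists_predual (M := N)
    exact ⟨⟨X, e⟩⟩)

/-- The weak-star topology of a `W*`-algebra: pointwise convergence on the predual. -/
@[reducible] def weakStarTopology (N : Type u) [CStarAlgebra N] [WStarAlgebra N] : TopologicalSpace N :=
  TopologicalSpace.induced
    (fun (a : N) (x : (predual N).X) => (predual N).equiv.symm a x) inferInstance

variable (N : Type u) [CStarAlgebra N] [PartialOrder N] [StarOrderedRing N] [WStarAlgebra N]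

/-- A normal faithful semi-finite trace on a `W*`-algebra.  Only the values on the positive cone
are meaningful. -/
structure NFSTrace where
  toFun : N → ℝ≥0∞
  map_add : ∀ a b : N, 0 ≤ a → 0 ≤ b → toFun (a + b) = toFun a + toFun b
  map_smul : ∀ (t : ℝ≥0) (a : N), 0 ≤ a → toFun (((t : ℝ) : ℂ) • a) = t * toFun a
  normal : @LowerSemicontinuousOn N ℝ≥0∞ (weakStarTopology N) _ toFun {a | 0 ≤ a}
  faithful : ∀ a : N, 0 ≤ a → toFun a = 0 → a = 0
  semifinite : @Dense N (weakStarTopology N)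
    (Submodule.span ℂ {a : N | 0 ≤ a ∧ toFun a < ∞} : Set N)
  trace : ∀ x : N, toFun (star x * x) = toFun (x * star x)

instance : CoeFun (NFSTrace N) (fun _ => N → ℝ≥0∞) := ⟨NFSTrace.toFun⟩

variable {N}

namespace NFSTrace

variable (τ : NFSTrace N)

lemma map_zero : τ (0 : N) = 0 := by
  simpa using τ.map_smul 0 0 le_rfl

lemma mono {a b : N} (ha : 0 ≤ a) (hab : a ≤ b) : τ a ≤ τ b := by
  have h := τ.map_add a (b - a) ha (sub_nonneg.2 hab)
  rw [add_sub_cancel] at h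
  rw [h]; exact le_self_add

lemma star_mul_self_smul (c : ℂ) (a : N) :
    τ (star (c • a) * (c • a)) = ENNReal.ofReal (‖c‖ ^ 2) * τ (star a * a) := by
  have h : star (c • a) * (c • a) = ((((‖c‖₊ ^ 2 : ℝ≥0) : ℝ)) : ℂ) • (star a * a) := by
    rw [star_smul, smul_mul_smul_comm]
    congr 1
    rw [Complex.star_def, Complex.conj_mul']
    simp
  rw [h, τ.map_smul _ _ (star_mul_self_nonneg a)]
  congr 1
  rw [ENNReal.ofReal_pow (norm_nonneg _), ofReal_norm]
  simp [enorm]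

lemma parallelogram (a b : N) :
    τ (star (a + b) * (a + b)) + τ (star (a - b) * (a - b))
      = 2 * (τ (star a * a) + τ (star b * b)) := by
  rw [← τ.map_add _ _ (star_mul_self_nonneg _) (star_mul_self_nonneg _),
    ← τ.map_add _ _ (star_mul_self_nonneg _) (star_mul_self_nonneg _)]
  have h0 : 0 ≤ star a * a + star b * b :=
    add_nonneg (star_mul_self_nonneg _) (star_mul_self_nonneg _)
  have h : star (a + b) * (a + b) + star (a - b) * (a - b)
      = (star a * a + star b * b) + (star a * a + star b * b) := by
    simp only [star_add, star_sub]; noncomm_ring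
  rw [h, τ.map_add _ _ h0 h0, two_mul]

/-- `𝔫 = {a : τ(a*a) < ∞}`. -/
def sqIntegrable : Submodule ℂ N where
  carrier := {a | τ (star a * a) < ∞}
  zero_mem' := by simp [τ.map_zero]
  add_mem' := by
    intro a b ha hb
    simp only [Set.mem_ofPred_eq] at *
    refine lt_of_le_of_lt le_self_add (lt_of_eq_of_lt (τ.parallelogram a b) ?_)
    exact ENNReal.mul_lt_top (by simp) (ENNReal.add_lt_top.2 ⟨ha, hb⟩)
  smul_mem' := by
    intro c a ha
    simp only [Set.mem_ofPred_eq] at *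
    rw [τ.star_mul_self_smul]
    exact ENNReal.mul_lt_top (by simp) ha

/-- A copy of `𝔫`, to be equipped with the norm `τ(a*a)^{1/2}`. -/
def PreL2 : Type u := τ.sqIntegrable

instance : AddCommGroup τ.PreL2 := inferInstanceAs (AddCommGroup τ.sqIntegrable)
instance : Module ℂ τ.PreL2 := inferInstanceAs (Module ℂ τ.sqIntegrable)

/-- The tautological identification of `𝔫` with its copy. -/
def toPreL2 : τ.sqIntegrable ≃ₗ[ℂ] τ.PreL2 := LinearEquiv.refl ℂ _

/-- The element of `N` underlying an element of `𝔫`. -/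
def val (a : τ.PreL2) : N := ((τ.toPreL2.symm a : τ.sqIntegrable) : N)

lemma val_lt_top (a : τ.PreL2) : τ (star (τ.val a) * τ.val a) < ∞ :=
  (τ.toPreL2.symm a : τ.sqIntegrable).2

@[simp] lemma val_add (a b : τ.PreL2) : τ.val (a + b) = τ.val a + τ.val b := rfl
@[simp] lemma val_sub (a b : τ.PreL2) : τ.val (a - b) = τ.val a - τ.val b := rfl
@[simp] lemma val_smul (c : ℂ) (a : τ.PreL2) : τ.val (c • a) = c • τ.val a := rfl
@[simp] lemma val_zero : τ.val 0 = 0 := rfl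

instance : Norm τ.PreL2 := ⟨fun a => Real.sqrt (τ (star (τ.val a) * τ.val a)).toReal⟩

lemma norm_def (a : τ.PreL2) : ‖a‖ = Real.sqrt (τ (star (τ.val a) * τ.val a)).toReal := rfl

lemma norm_sq (a : τ.PreL2) : ‖a‖ ^ 2 = (τ (star (τ.val a) * τ.val a)).toReal := by
  rw [norm_def, Real.sq_sqrt ENNReal.toReal_nonneg]

lemma norm_par (a b : τ.PreL2) :
    ‖a + b‖ ^ 2 + ‖a - b‖ ^ 2 = 2 * (‖a‖ ^ 2 + ‖b‖ ^ 2) := by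
  have h := congrArg ENNReal.toReal (τ.parallelogram (τ.val a) (τ.val b))
  have f1 := (τ.val_lt_top (a + b)).ne
  have f2 := (τ.val_lt_top (a - b)).ne
  rw [val_add] at f1
  rw [val_sub] at f2
  rw [ENNReal.toReal_add f1 f2, ENNReal.toReal_mul, ENNReal.toReal_add (τ.val_lt_top a).ne (τ.val_lt_top b).ne] at h
  simpa [norm_sq] using h

lemma norm_smul_pre (c : ℂ) (a : τ.PreL2) : ‖c • a‖ = ‖c‖ * ‖a‖ := by
  have h : ‖c • a‖ ^ 2 = (‖c‖ * ‖a‖) ^ 2 := by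
    rw [mul_pow, norm_sq, norm_sq, val_smul, star_mul_self_smul, ENNReal.toReal_mul,
      ENNReal.toReal_ofReal (by positivity)]
  exact (sq_eq_sq₀ (Real.sqrt_nonneg _)
    (mul_nonneg (norm_nonneg c) (Real.sqrt_nonneg _))).1 h

lemma norm_add_sq_le (a b : τ.PreL2) (s : ℝ) (hs : 0 < s) :
    ‖a + b‖ ^ 2 ≤ (1 + s) * ‖a‖ ^ 2 + (1 + s⁻¹) * ‖b‖ ^ 2 := by
  -- parallelogram law applied to `r a` and `r⁻¹ b`, `r² = s`
  set r : ℝ := Real.sqrt s with hr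
  have hr0 : 0 < r := Real.sqrt_pos.2 hs
  have hr2 : r ^ 2 = s := Real.sq_sqrt hs.le
  have hrc : (r : ℂ) ≠ 0 := by exact_mod_cast hr0.ne'
  have key : star (τ.val a + τ.val b) * (τ.val a + τ.val b)
      + star ((r : ℂ) • τ.val a - (r : ℂ)⁻¹ • τ.val b)
        * ((r : ℂ) • τ.val a - (r : ℂ)⁻¹ • τ.val b)
      = (star (τ.val a) * τ.val a + star (τ.val b) * τ.val b)
        + (star ((r : ℂ) • τ.val a) * ((r : ℂ) • τ.val a)
          + star ((r : ℂ)⁻¹ • τ.val b) * ((r : ℂ)⁻¹ • τ.val b)) := by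
    simp only [star_add, star_sub, star_smul, add_mul, mul_add, sub_mul, mul_sub,
      smul_mul_smul_comm, Complex.star_def, map_inv₀, Complex.conj_ofReal,
      mul_inv_cancel₀ hrc, inv_mul_cancel₀ hrc, one_smul]
    abel
  have h := congrArg τ.toFun key
  have p : ∀ x : N, 0 ≤ star x * x := fun x => star_mul_self_nonneg x
  rw [τ.map_add _ _ (p _) (p _), τ.map_add _ _ (add_nonneg (p _) (p _))
    (add_nonneg (p _) (p _)), τ.map_add _ _ (p _) (p _), τ.map_add _ _ (p _) (p _)] at h
  have f : ∀ x : τ.PreL2, τ (star (τ.val x) * τ.val x) ≠ ∞ := fun x => (τ.val_lt_top x).ne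
  have h' := congrArg ENNReal.toReal h
  have f1 := f (a + b)
  have f2 := f ((r : ℂ) • a - (r : ℂ)⁻¹ • b)
  have f3 := f ((r : ℂ) • a)
  have f4 := f ((r : ℂ)⁻¹ • b)
  simp only [val_add, val_sub, val_smul] at f1 f2 f3 f4
  rw [ENNReal.toReal_add f1 f2, ENNReal.toReal_add (ENNReal.add_ne_top.2 ⟨f a, f b⟩)
    (ENNReal.add_ne_top.2 ⟨f3, f4⟩), ENNReal.toReal_add (f a) (f b),
    ENNReal.toReal_add f3 f4, star_mul_self_smul, star_mul_self_smul, ENNReal.toReal_mul,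
    ENNReal.toReal_mul, ENNReal.toReal_ofReal (by positivity),
    ENNReal.toReal_ofReal (by positivity)] at h'
  rw [norm_sq, norm_sq, norm_sq, val_add]
  have e1 : ‖(r : ℂ)‖ ^ 2 = s := by
    rw [Complex.norm_real, Real.norm_eq_abs, sq_abs, hr2]
  have e2 : ‖(r : ℂ)⁻¹‖ ^ 2 = s⁻¹ := by rw [norm_inv, inv_pow, e1]
  rw [e1, e2] at h'
  have : 0 ≤ (τ (star ((r : ℂ) • τ.val a - (r : ℂ)⁻¹ • τ.val b)
        * ((r : ℂ) • τ.val a - (r : ℂ)⁻¹ • τ.val b))).toReal := ENNReal.toReal_nonneg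
  linarith

lemma norm_eq_zero_pre (a : τ.PreL2) : ‖a‖ = 0 ↔ a = 0 := by
  constructor
  · intro h
    rw [norm_def, Real.sqrt_eq_zero ENNReal.toReal_nonneg, ENNReal.toReal_eq_zero_iff] at h
    have h0 := τ.faithful _ (star_mul_self_nonneg _) (h.resolve_right (τ.val_lt_top a).ne)
    have h1 : τ.val a = 0 := (CStarRing.star_mul_self_eq_zero_iff _).1 h0
    exact Subtype.ext h1
  · rintro rfl
    simp [norm_def, τ.map_zero]

lemma norm_triangle_pre (a b : τ.PreL2) : ‖a + b‖ ≤ ‖a‖ + ‖b‖ := by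
  have na : 0 ≤ ‖a‖ := Real.sqrt_nonneg _
  have nb : 0 ≤ ‖b‖ := Real.sqrt_nonneg _
  rcases na.eq_or_lt with ha | ha
  · rw [← ha, (τ.norm_eq_zero_pre a).1 ha.symm, zero_add, zero_add]
  rcases nb.eq_or_lt with hb | hb
  · rw [← hb, (τ.norm_eq_zero_pre b).1 hb.symm, add_zero, add_zero]
  have h := τ.norm_add_sq_le a b (‖b‖ / ‖a‖) (by positivity)
  have e : (1 + ‖b‖ / ‖a‖) * ‖a‖ ^ 2 + (1 + (‖b‖ / ‖a‖)⁻¹) * ‖b‖ ^ 2 = (‖a‖ + ‖b‖) ^ 2 := by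
    field_simp
    ring
  rw [e] at h
  exact (sq_le_sq₀ (Real.sqrt_nonneg _) (by positivity)).1 h

lemma core : NormedSpace.Core ℂ τ.PreL2 where
  norm_nonneg _ := Real.sqrt_nonneg _
  norm_smul := τ.norm_smul_pre
  norm_triangle := τ.norm_triangle_pre
  norm_eq_zero_iff := τ.norm_eq_zero_pre

instance : NormedAddCommGroup τ.PreL2 := NormedAddCommGroup.ofCore τ.core
instance : NormedSpace ℂ τ.PreL2 := NormedSpace.ofCore τ.core

/-- The inner product `⟨a, b⟩ = τ(a* b)` on `𝔫`, `τ(a* b)` being given by polarization of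
`τ(a* a)`; it is conjugate-linear in the first variable. -/
instance : InnerProductSpace ℂ τ.PreL2 :=
  InnerProductSpace.ofNorm ℂ (fun a b => by simpa only [pow_two] using τ.norm_par a b)

/-- The Hilbert space `L²(τ)`. -/
abbrev L2 : Type u := UniformSpace.Completion τ.PreL2

/-- The embedding `𝔫 → L²(τ)`. -/
def toL2 : τ.sqIntegrable →ₗ[ℂ] τ.L2 :=
  (UniformSpace.Completion.toComplL (𝕜 := ℂ) (E := τ.PreL2)).toLinearMap ∘ₗ
    τ.toPreL2.toLinearMap

lemma toL2_injective : Function.Injective τ.toL2 := by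
  intro a b h
  exact τ.toPreL2.injective (UniformSpace.Completion.coe_injective _ h)

end NFSTrace

/-! ### Markov semigroups and the Dirichlet form -/

variable (N) in
/-- A Markov semigroup on a `W*`-algebra. -/
structure MarkovSemigroup where
  toFun : ℝ≥0 → (N →CP N)
  contraction : ∀ t a, ‖toFun t a‖ ≤ ‖a‖
  map_one : ∀ t, toFun t 1 = 1
  zero : ∀ a, toFun 0 a = a
  semigroup : ∀ s t a, toFun (s + t) a = toFun s (toFun t a)
  continuous : ∀ a, Tendsto (fun t => toFun t a) (𝓝 0) (@nhds N (weakStarTopology N) a)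

instance : CoeFun (MarkovSemigroup N) (fun _ => ℝ≥0 → (N →CP N)) := ⟨MarkovSemigroup.toFun⟩

variable (N) in
/-- A Markov semigroup `(P_t)` on the `W*`-algebra `N` together with a symmetric normal faithful
semi-finite trace `τ`: `τ(a P_t(b)) = τ(P_t(a) b)` for `a, b ≥ 0`, where, for positive `x, y`,
`τ(x y)` means `τ(x^{1/2} y x^{1/2}) ∈ [0, ∞]`. -/
structure SymmetricMarkovTriple where
  τ : NFSTrace N
  P : MarkovSemigroup N
  symmetric : ∀ (t : ℝ≥0) (a b : N), 0 ≤ a → 0 ≤ b →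
    τ (CFC.sqrt a * P t b * CFC.sqrt a) = τ (CFC.sqrt b * P t a * CFC.sqrt b)

lemma cstarMatrix_diag_nonneg (M : CStarMatrix (Fin 2) (Fin 2) N) (hM : 0 ≤ M) : 0 ≤ M 0 0 := by
  rw [StarOrderedRing.nonneg_iff] at hM
  induction hM using AddSubmonoid.closure_induction with
  | mem x hx =>
    obtain ⟨X, rfl⟩ := hx
    simp only [CStarMatrix.mul_apply]
    refine Finset.sum_nonneg fun k _ => ?_
    rw [CStarMatrix.star_apply]
    exact star_mul_self_nonneg _
  | zero => simp
  | add x y _ _ hx hy => rw [CStarMatrix.add_apply]; exact add_nonneg hx hy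

/-- The Kadison–Schwarz inequality. -/
lemma kadison_schwarz (P : N →CP N) (h1 : P 1 = 1) (a : N) :
    star (P a) * P a ≤ P (star a * a) := by
  let V : CStarMatrix (Fin 2) (Fin 2) N := CStarMatrix.ofMatrix !![a, 1; 0, 0]
  have hM := P.map_cstarMatrix_nonneg _ (star_mul_self_nonneg V)
  let W : CStarMatrix (Fin 2) (Fin 2) N := CStarMatrix.ofMatrix !![1, 0; -P a, 0]
  have h := cstarMatrix_diag_nonneg _ (star_left_conjugate_nonneg hM W)
  have hstar : P (star a) = star (P a) := map_star P a
  simp [CStarMatrix.mul_apply, Fin.sum_univ_two, CStarMatrix.star_apply, V, W, h1, hstar] at h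
  simpa [add_mul, sub_nonneg] using h

namespace SymmetricMarkovTriple

variable (T : SymmetricMarkovTriple N)

lemma trace_P (t : ℝ≥0) {b : N} (hb : 0 ≤ b) : T.τ (T.P t b) = T.τ b := by
  have h := T.symmetric t 1 b zero_le_one hb
  rw [T.P.map_one] at h
  simpa [CFC.sqrt_mul_sqrt_self b hb] using h

lemma trace_P_sq (t : ℝ≥0) (a : N) :
    T.τ (star (T.P t a) * T.P t a) ≤ T.τ (star a * a) :=
  (T.τ.mono (star_mul_self_nonneg _) (kadison_schwarz _ (T.P.map_one t) a)).trans_eq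
    (T.trace_P t (star_mul_self_nonneg a))

/-- `P_t` on `𝔫`. -/
def preP2 (t : ℝ≥0) : T.τ.PreL2 →L[ℂ] T.τ.PreL2 :=
  LinearMap.mkContinuous
    { toFun := fun a => T.τ.toPreL2
        ⟨T.P t (T.τ.val a), (T.trace_P_sq t _).trans_lt (T.τ.val_lt_top a)⟩
      map_add' := fun a b => Subtype.ext (by exact map_add (T.P t) (T.τ.val a) (T.τ.val b))
      map_smul' := fun c a => Subtype.ext (by exact map_smul (T.P t) c (T.τ.val a)) } 1
    (fun a => by
      rw [one_mul]
      exact Real.sqrt_le_sqrt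
        (ENNReal.toReal_mono (T.τ.val_lt_top a).ne (T.trace_P_sq t _)))

/-- The `L²`-semigroup `P_t^{(2)}`, the continuous extension of `P_t|_𝔫` to `L²(τ)`. -/
def P2 (t : ℝ≥0) : T.τ.L2 →L[ℂ] T.τ.L2 := (T.preP2 t).completion

lemma norm_preP2_le (t : ℝ≥0) (a : T.τ.PreL2) : ‖T.preP2 t a‖ ≤ ‖a‖ :=
  Real.sqrt_le_sqrt (ENNReal.toReal_mono (T.τ.val_lt_top a).ne (T.trace_P_sq t _))

lemma P2_coe (t : ℝ≥0) (a : T.τ.PreL2) : T.P2 t (a : T.τ.L2) = (T.preP2 t a : T.τ.L2) := by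
  simp [P2]

lemma norm_P2_le (t : ℝ≥0) (u : T.τ.L2) : ‖T.P2 t u‖ ≤ ‖u‖ := by
  induction u using UniformSpace.Completion.induction_on with
  | hp => exact isClosed_le (by fun_prop) (by fun_prop)
  | ih a => rw [P2_coe]; simpa using T.norm_preP2_le t a

/-- The approximating form `t⁻¹ ⟨u, u - P_t u⟩`. -/
def approx (t : ℝ≥0) (u : T.τ.L2) : ℝ := (inner ℂ u (u - T.P2 t u)).re / t

/-- The Dirichlet form `ℰ[u] ∈ [0, ∞]` of the semigroup, `ℰ[u] = lim_{t ↘ 0} t⁻¹ ⟨u, u - P_t u⟩`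
(the quotient increases as `t` decreases), that is `ℰ[u] = ‖Δ^{1/2} u‖²` for the nonnegative
generator `Δ = lim_{t ↘ 0} t⁻¹ (1 - P_t)` of the `L²`-semigroup. -/
def energy (u : T.τ.L2) : ℝ≥0∞ := ⨆ t : {t : ℝ≥0 // 0 < t}, ENNReal.ofReal (T.approx t u)

lemma approx_nonneg (t : ℝ≥0) (u : T.τ.L2) : 0 ≤ T.approx t u := by
  refine div_nonneg ?_ t.2
  rw [inner_sub_right, Complex.sub_re, sub_nonneg]
  have h1 : (inner ℂ u (T.P2 t u)).re ≤ ‖u‖ * ‖T.P2 t u‖ :=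
    (Complex.re_le_norm _).trans (norm_inner_le_norm _ _)
  have h2 : ‖u‖ * ‖T.P2 t u‖ ≤ ‖u‖ * ‖u‖ :=
    mul_le_mul_of_nonneg_left (T.norm_P2_le t u) (norm_nonneg u)
  have h3 : (inner ℂ u u).re = ‖u‖ * ‖u‖ := inner_self_eq_norm_mul_norm (𝕜 := ℂ) u
  linarith

lemma approx_par (t : ℝ≥0) (u v : T.τ.L2) :
    T.approx t (u + v) + T.approx t (u - v) = 2 * (T.approx t u + T.approx t v) := by
  simp only [approx, map_add, map_sub, inner_add_left, inner_add_right, inner_sub_left,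
    inner_sub_right, Complex.add_re, Complex.sub_re]
  ring

lemma approx_smul (t : ℝ≥0) (c : ℂ) (u : T.τ.L2) :
    T.approx t (c • u) = ‖c‖ ^ 2 * T.approx t u := by
  simp only [approx, map_smul, ← smul_sub, inner_smul_left, inner_smul_right]
  rw [← mul_assoc, Complex.mul_conj', ← Complex.ofReal_pow, Complex.re_ofReal_mul, mul_div_assoc]

lemma energy_smul (c : ℂ) (u : T.τ.L2) :
    T.energy (c • u) = ENNReal.ofReal (‖c‖ ^ 2) * T.energy u := by
  simp only [energy, approx_smul, ENNReal.mul_iSup]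
  congr 1; ext t
  rw [ENNReal.ofReal_mul (by positivity)]

lemma energy_add_le (u v : T.τ.L2) :
    T.energy (u + v) ≤ 2 * (T.energy u + T.energy v) := by
  refine iSup_le fun t => ?_
  have h : T.approx t (u + v) ≤ 2 * (T.approx t u + T.approx t v) := by
    have := T.approx_par t u v
    have := T.approx_nonneg t (u - v)
    linarith
  refine (ENNReal.ofReal_le_ofReal h).trans ?_
  rw [ENNReal.ofReal_mul (by norm_num), ENNReal.ofReal_add (T.approx_nonneg _ _)
    (T.approx_nonneg _ _)]
  simp only [ENNReal.ofReal_ofNat]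
  gcongr
  · exact le_iSup (fun t : {t : ℝ≥0 // 0 < t} => ENNReal.ofReal (T.approx t u)) t
  · exact le_iSup (fun t : {t : ℝ≥0 // 0 < t} => ENNReal.ofReal (T.approx t v)) t

lemma energy_zero : T.energy 0 = 0 := by simp [energy, approx]

/-- The domain `D(ℰ) = {u ∈ L²(τ) : ℰ[u] < ∞}`. -/
def dom : Submodule ℂ T.τ.L2 where
  carrier := {u | T.energy u < ∞}
  zero_mem' := by simp [energy_zero]
  add_mem' := fun {u v} hu hv => (T.energy_add_le u v).trans_lt
    (ENNReal.mul_lt_top (by simp) (ENNReal.add_lt_top.2 ⟨hu, hv⟩))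
  smul_mem' := fun c u hu => by
    simp only [Set.mem_ofPred_eq, energy_smul] at *
    exact ENNReal.mul_lt_top (by simp) hu

/-- The Hermitian form `ℰ(u, v)`, for `u, v ∈ D(ℰ)`, obtained from `ℰ[u]` by polarization; it is
conjugate-linear in the first variable. -/
def form (u v : T.dom) : ℂ :=
  (((T.energy (u + v : T.τ.L2)).toReal : ℂ) - (T.energy (u - v : T.τ.L2)).toReal
    - Complex.I * (T.energy (u + Complex.I • v : T.τ.L2)).toReal
    + Complex.I * (T.energy (u - Complex.I • v : T.τ.L2)).toReal) / 4

lemma form_self (u : T.dom) : T.form u u = ((T.energy u).toReal : ℂ) := by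
  have e1 : (u + u : T.τ.L2) = (2 : ℂ) • (u : T.τ.L2) := (two_smul ℂ _).symm
  have e2 : (u + Complex.I • u : T.τ.L2) = (1 + Complex.I) • (u : T.τ.L2) := by
    rw [add_smul, one_smul]
  have e3 : (u - Complex.I • u : T.τ.L2) = (1 - Complex.I) • (u : T.τ.L2) := by
    rw [sub_smul, one_smul]
  have n2 : ‖(1 + Complex.I : ℂ)‖ ^ 2 = 2 := by
    rw [← Complex.normSq_eq_norm_sq]; simp [Complex.normSq_apply]; norm_num
  have n3 : ‖(1 - Complex.I : ℂ)‖ ^ 2 = 2 := by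
    rw [← Complex.normSq_eq_norm_sq]; simp [Complex.normSq_apply]; norm_num
  rw [form, e1, e2, e3, sub_self, energy_zero, energy_smul, energy_smul, energy_smul, n2, n3]
  simp
  ring

/-- `ker ℰ = {u ∈ D(ℰ) : ℰ[u] = 0}`. -/
def ker : Submodule ℂ T.dom where
  carrier := {u | T.energy u = 0}
  zero_mem' := by simp [energy_zero]
  add_mem' := fun {u v} hu hv => by
    have h := T.energy_add_le u v
    simp only [Set.mem_ofPred_eq] at hu hv ⊢
    rw [hu, hv] at h
    simpa using h
  smul_mem' := fun c u hu => by
    simp only [Set.mem_ofPred_eq] at hu ⊢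
    rw [Submodule.coe_smul, energy_smul, hu, mul_zero]

/-- The quotient `D₀(ℰ) = D(ℰ) / ker ℰ`. -/
abbrev D0 : Type u := T.dom ⧸ T.ker

/-! ### Regular subalgebras and differential calculi -/

/-- `ℬ = D(ℰ) ∩ 𝒜`, as a subspace of `𝔫`. -/
def coreAlg (A : NonUnitalStarSubalgebra ℂ N) : Submodule ℂ T.τ.sqIntegrable :=
  A.toSubmodule.comap T.τ.sqIntegrable.subtype ⊓ T.dom.comap T.τ.toL2

variable {T}

/-- The element of `𝒜` given by an element of `ℬ`. -/
def coreToAlg {A : NonUnitalStarSubalgebra ℂ N} (b : T.coreAlg A) : A :=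
  ⟨((b : T.τ.sqIntegrable) : N), b.2.1⟩

/-- The inclusion `ℬ → D(ℰ)`. -/
def coreToDom {A : NonUnitalStarSubalgebra ℂ N} : T.coreAlg A →ₗ[ℂ] T.dom :=
  (T.τ.toL2 ∘ₗ (T.coreAlg A).subtype).codRestrict T.dom (fun b => b.2.2)

variable (T)

/-- `𝒜` is a regular `C*`-subalgebra of `N`.  (The restriction of `τ` to `𝒜` is automatically a
faithful lower semicontinuous trace.) -/
structure IsRegular (A : NonUnitalStarSubalgebra ℂ N) : Prop where
  isClosed : IsClosed (A : Set N)
  semifinite : (A : Set N) ⊆ closure (Submodule.span ℂ {a : N | a ∈ A ∧ 0 ≤ a ∧ T.τ a < ∞} : Set N)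
  dense_sqIntegrable : (A : Set N) ⊆ closure {a : N | a ∈ A ∧ a ∈ T.τ.sqIntegrable}
  dense_core : (A : Set N) ⊆ closure (Set.range fun b : T.coreAlg A => ((b : T.τ.sqIntegrable) : N))
  form_dense : ∀ u : T.dom, ∀ ε : ℝ≥0∞, 0 < ε → ∃ b : T.coreAlg A,
    ENNReal.ofReal (‖(u - coreToDom b : T.τ.L2)‖ ^ 2) + T.energy (u - coreToDom b : T.τ.L2) < ε

/-- The inclusion `ℬ → L²(τ)`. -/
def coreToL2 (A : NonUnitalStarSubalgebra ℂ N) : T.coreAlg A →ₗ[ℂ] T.τ.L2 :=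
  T.τ.toL2 ∘ₗ (T.coreAlg A).subtype

lemma coreToL2_injective (A : NonUnitalStarSubalgebra ℂ N) :
    Function.Injective (T.coreToL2 A) :=
  fun _ _ h => Subtype.ext (T.τ.toL2_injective h)

/-- A linear map `ℬ → ℋ` viewed as a densely defined operator from `L²(τ)` to `ℋ`. -/
def toPMap {A : NonUnitalStarSubalgebra ℂ N} {H : Type v} [NormedAddCommGroup H]
    [InnerProductSpace ℂ H] (d : T.coreAlg A →ₗ[ℂ] H) : T.τ.L2 →ₗ.[ℂ] H where
  domain := LinearMap.range (T.coreToL2 A)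
  toFun := d ∘ₗ
    (LinearEquiv.ofInjective (T.coreToL2 A) (T.coreToL2_injective A)).symm.toLinearMap

lemma toPMap_mem_graph {A : NonUnitalStarSubalgebra ℂ N} {H : Type v} [NormedAddCommGroup H]
    [InnerProductSpace ℂ H] (d : T.coreAlg A →ₗ[ℂ] H) (b : T.coreAlg A) :
    (T.coreToL2 A b, d b) ∈ (T.toPMap d).graph := by
  refine (LinearPMap.mem_graph_iff _).2 ⟨⟨_, LinearMap.mem_range_self _ b⟩, rfl, ?_⟩
  change d ((LinearEquiv.ofInjective (T.coreToL2 A) (T.coreToL2_injective A)).symm _) = d b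
  congr 1
  exact (LinearEquiv.symm_apply_eq _).2 rfl

/-- A symmetric differential calculus `(ℋ, J, ∂)` over `𝒜` with `∂` defined on `ℬ = D(ℰ) ∩ 𝒜`.
The bimodule structure is a pair of commuting `*`-representations of `𝒜` and of the opposite
algebra of `𝒜`. -/
structure SymmetricDifferentialCalculus (A : NonUnitalStarSubalgebra ℂ N) (H : Type v)
    [NormedAddCommGroup H] [InnerProductSpace ℂ H] [CompleteSpace H] where
  left : A →⋆ₙₐ[ℂ] (H →L[ℂ] H)
  right : Aᵐᵒᵖ →⋆ₙₐ[ℂ] (H →L[ℂ] H)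
  left_right : ∀ (a b : A) (h : H),
    left a (right (MulOpposite.op b) h) = right (MulOpposite.op b) (left a h)
  J : H →ₗ⋆[ℂ] H
  J_J : ∀ h, J (J h) = h
  J_bimodule : ∀ (a b : A) (h : H), J (left a (right (MulOpposite.op b) h))
    = left (star b) (right (MulOpposite.op (star a)) (J h))
  d : T.coreAlg A →ₗ[ℂ] H
  d_star : ∀ a c : T.coreAlg A, coreToAlg c = star (coreToAlg a) → d c = J (d a)
  d_mul : ∀ a b c : T.coreAlg A, coreToAlg c = coreToAlg a * coreToAlg b →
    d c = right (MulOpposite.op (coreToAlg b)) (d a) + left (coreToAlg a) (d b)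
  closable : (T.toPMap d).IsClosable

/-- A symmetric differential calculus associated with the Dirichlet form:
`ℰ(a, b) = ⟨∂a, ∂b⟩` on `ℬ`. -/
structure DirichletCalculus (A : NonUnitalStarSubalgebra ℂ N) (H : Type v)
    [NormedAddCommGroup H] [InnerProductSpace ℂ H] [CompleteSpace H]
    extends SymmetricDifferentialCalculus T A H where
  form_eq : ∀ a b : T.coreAlg A, T.form (coreToDom a) (coreToDom b) = inner ℂ (d a) (d b)

end SymmetricMarkovTriple

namespace SymmetricMarkovTriple.DirichletCalculus

variable {T : SymmetricMarkovTriple N} {A : NonUnitalStarSubalgebra ℂ N} {H : Type v}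
  [NormedAddCommGroup H] [InnerProductSpace ℂ H] [CompleteSpace H]
  (C : T.DirichletCalculus A H)

lemma energy_eq (b : T.coreAlg A) :
    T.energy (coreToDom b : T.dom) = ENNReal.ofReal (‖C.d b‖ ^ 2) := by
  have h := C.form_eq b b
  rw [form_self, inner_self_eq_norm_sq_to_K] at h
  have h' : (T.energy (coreToDom b : T.dom)).toReal = ‖C.d b‖ ^ 2 := by
    have h2 := congrArg Complex.re h
    rw [Complex.ofReal_re] at h2
    rw [h2]; norm_cast
  rw [← h', ENNReal.ofReal_toReal (coreToDom b : T.dom).2.ne]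

/-- The closure of `∂` as an operator from `L²(τ)` to `ℋ`. -/
def closedD : T.τ.L2 →ₗ.[ℂ] H := (T.toPMap C.d).closure

lemma dom_le (hA : T.IsRegular A) : T.dom ≤ C.closedD.domain := by
  intro u hu
  have hε : ∀ n : ℕ, (0 : ℝ≥0∞) < ENNReal.ofReal ((1 / 2 : ℝ) ^ n) := fun n => by
    rw [ENNReal.ofReal_pos]; positivity
  choose b hb using fun n => hA.form_dense ⟨u, hu⟩ _ (hε n)
  have hb1 : ∀ n, ‖(u - coreToDom (b n) : T.τ.L2)‖ ^ 2 ≤ (1 / 2 : ℝ) ^ n := fun n =>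
    (ENNReal.ofReal_le_ofReal_iff (by positivity)).1 (le_self_add.trans (hb n).le)
  have hb2 : ∀ n, T.energy (u - coreToDom (b n) : T.τ.L2) ≤ ENNReal.ofReal ((1 / 2 : ℝ) ^ n) :=
    fun n => le_add_self.trans (hb n).le
  have hlim : Tendsto (fun n => ((coreToDom (b n) : T.dom) : T.τ.L2)) atTop (𝓝 u) := by
    rw [tendsto_iff_norm_sub_tendsto_zero]
    have h0 : Tendsto (fun n : ℕ => Real.sqrt ((1 / 2 : ℝ) ^ n)) atTop (𝓝 0) := by
      have := (tendsto_pow_atTop_nhds_zero_of_lt_one (r := (1 / 2 : ℝ)) (by norm_num)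
        (by norm_num)).sqrt
      simpa using this
    refine squeeze_zero (fun _ => norm_nonneg _) (fun n => ?_) h0
    rw [norm_sub_rev]
    exact Real.le_sqrt_of_sq_le (hb1 n)
  have hcau : CauchySeq (fun n => C.d (b n)) := by
    have hd : ∀ n m k : ℕ, k ≤ n → k ≤ m →
        dist (C.d (b n)) (C.d (b m)) ≤ Real.sqrt (4 * (1 / 2 : ℝ) ^ k) := by
      intro n m k hn hm
      rw [dist_eq_norm, ← map_sub]
      refine Real.le_sqrt_of_sq_le ?_
      rw [← ENNReal.ofReal_le_ofReal_iff (by positivity), ← C.energy_eq]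
      have e : ((coreToDom (b n - b m) : T.dom) : T.τ.L2)
          = (u - coreToDom (b m) : T.τ.L2) + (-1 : ℂ) • (u - coreToDom (b n) : T.τ.L2) := by
        rw [map_sub, Submodule.coe_sub, neg_one_smul]; abel
      rw [e]
      refine (T.energy_add_le _ _).trans ?_
      rw [T.energy_smul]
      have hpow : ∀ j, k ≤ j → T.energy (u - coreToDom (b j) : T.τ.L2)
          ≤ ENNReal.ofReal ((1 / 2 : ℝ) ^ k) := fun j hj =>
        (hb2 j).trans (ENNReal.ofReal_le_ofReal
          (pow_le_pow_of_le_one (by norm_num) (by norm_num) hj))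
      calc 2 * (T.energy (u - coreToDom (b m) : T.τ.L2)
            + ENNReal.ofReal (‖(-1 : ℂ)‖ ^ 2) * T.energy (u - coreToDom (b n) : T.τ.L2))
          ≤ 2 * (ENNReal.ofReal ((1 / 2 : ℝ) ^ k) + ENNReal.ofReal ((1 / 2 : ℝ) ^ k)) := by
            gcongr
            · exact hpow m hm
            · simpa using hpow n hn
        _ = ENNReal.ofReal (4 * (1 / 2 : ℝ) ^ k) := by
            rw [← ENNReal.ofReal_add (by positivity) (by positivity), ← ENNReal.ofReal_ofNat,
              ← ENNReal.ofReal_mul (by norm_num)]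
            congr 1; ring
    refine cauchySeq_of_le_tendsto_0 (fun k : ℕ => Real.sqrt (4 * (1 / 2 : ℝ) ^ k)) hd ?_
    have := ((tendsto_pow_atTop_nhds_zero_of_lt_one (r := (1 / 2 : ℝ)) (by norm_num)
        (by norm_num)).const_mul 4).sqrt
    simpa using this
  obtain ⟨h, hh⟩ := cauchySeq_tendsto_of_complete hcau
  have hmem : (u, h) ∈ (T.toPMap C.d).graph.topologicalClosure := by
    refine mem_closure_of_tendsto (hlim.prodMk_nhds hh) (Eventually.of_forall fun n => ?_)
    exact T.toPMap_mem_graph C.d (b n)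
  rw [C.closable.graph_closure_eq_closure_graph] at hmem
  exact LinearPMap.mem_domain_of_mem_graph hmem

/-- The gradient `∂ : D(ℰ) → ℋ` (the closure of `∂ : ℬ → ℋ`). -/
def grad (hA : T.IsRegular A) : T.dom →ₗ[ℂ] H :=
  C.closedD.toFun ∘ₗ Submodule.inclusion (C.dom_le hA)

/-- `u ∈ D(ℰ)` is a weak solution of `∂* F(∂u) = f`. -/
def IsWeakSolution (hA : T.IsRegular A) (F : H → H) (f u : T.dom) : Prop :=
  ∀ g : T.dom, inner ℂ (F (C.grad hA u)) (C.grad hA g) = inner ℂ (f : T.τ.L2) (g : T.τ.L2)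

/-- A class `U ∈ D₀(ℰ)` is a weak solution of `∂* F(∂u) = f` if it is represented by a weak
solution in `D(ℰ)`. -/
def IsWeakSolution₀ (hA : T.IsRegular A) (F : H → H) (f : T.dom) (U : T.D0) : Prop :=
  ∃ u : T.dom, T.ker.mkQ u = U ∧ C.IsWeakSolution hA F f u

end SymmetricMarkovTriple.DirichletCalculus

end

end NCDirichlet

namespace NCDirichlet.SymmetricMarkovTriple

open scoped ENNReal NNReal

variable {N : Type u} [CStarAlgebra N] [PartialOrder N] [StarOrderedRing N] [WStarAlgebra N]

/-! If `u` and `v` are weak solutions, both equations may be tested against `g = u - v`. The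
right-hand sides coincide, so `⟨F(∂u) - F(∂v), ∂u - ∂v⟩ = 0`, and strong monotonicity forces `∂(u -
v) = 0` (`grad_sub_eq_zero`). No existence theory and no continuity of `F` enter.

It remains to see that a vanishing gradient means vanishing energy. The identity `ℰ[b] = ‖∂b‖²` is
given only on `ℬ`, while `u - v` is a general element of `D(ℰ)`, where `∂` is the closure. The
inequality `ℰ[u] ≤ ‖∂u‖²` is enough (`energy_le_norm_grad_sq`), and it is a lower semicontinuity
statement: `ℰ` is the supremum over `t > 0` of the forms `T.approx t`, each continuous on `L²(τ)`
because `P_t^{(2)}` is bounded. For fixed `t` the bound `approx t ≤ ‖∂·‖²` therefore passes from the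
graph of `∂` on `ℬ` to its closure (`approx_le_of_mem_graph_closedD`), and the supremum is taken
afterwards. -/

lemma continuous_approx (T : SymmetricMarkovTriple N) (t : ℝ≥0) : Continuous (T.approx t) := by
  unfold approx
  fun_prop

/-! ### Energy bounded by the closed gradient -/

namespace DirichletCalculus

variable {T : SymmetricMarkovTriple N} {A : NonUnitalStarSubalgebra ℂ N} {H : Type v}
  [NormedAddCommGroup H] [InnerProductSpace ℂ H] [CompleteSpace H] (C : T.DirichletCalculus A H)

lemma approx_coreToL2_le (b : T.coreAlg A) {t : ℝ≥0} (ht : 0 < t) :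
    T.approx t (T.coreToL2 A b) ≤ ‖C.d b‖ ^ 2 := by
  rw [← ENNReal.ofReal_le_ofReal_iff (by positivity), ← C.energy_eq b]
  exact le_iSup (fun t : {t : ℝ≥0 // 0 < t} => ENNReal.ofReal (T.approx t (T.coreToL2 A b))) ⟨t, ht⟩

/-- For fixed `t` both sides are continuous in `p`, so the condition is closed in `L²(τ) × ℋ` and
need only be checked on the graph of `∂` over `ℬ`. The energy itself need not be continuous on
`L²(τ)`, which is why the limit is taken one `t` at a time. -/
lemma approx_le_of_mem_graph_closedD {p : T.τ.L2 × H} (hp : p ∈ C.closedD.graph)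
    {t : ℝ≥0} (ht : 0 < t) : T.approx t p.1 ≤ ‖p.2‖ ^ 2 := by
  -- Closability is used here: the graph of the closed operator is the topological closure of the
  -- graph over `ℬ`.
  rw [closedD, ← C.closable.graph_closure_eq_closure_graph] at hp
  have hclosed : IsClosed {q : T.τ.L2 × H | T.approx t q.1 ≤ ‖q.2‖ ^ 2} :=
    isClosed_le ((T.continuous_approx t).comp continuous_fst) (by fun_prop)
  refine closure_minimal (fun q hq => ?_) hclosed hp
  obtain ⟨⟨_, b, rfl⟩, h1, h2⟩ := (LinearPMap.mem_graph_iff _).1 hq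
  -- `toPMap` evaluates `d` through the inverse of `coreToL2`; its value at `coreToL2 b` is
  -- identified with `d b` by comparing two points of the domain with the same underlying vector.
  have hd := (LinearPMap.mem_graph_iff _).1 (T.toPMap_mem_graph C.d b)
  obtain ⟨y, hy1, hy2⟩ := hd
  have hy : y = ⟨T.coreToL2 A b, LinearMap.mem_range_self _ b⟩ := Subtype.ext hy1
  change T.approx t q.1 ≤ ‖q.2‖ ^ 2
  rw [← h1, ← h2]
  rw [hy] at hy2
  exact (C.approx_coreToL2_le b ht).trans_eq (congrArg (‖·‖ ^ 2) hy2.symm)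

/-- `ℰ[u] ≤ ‖∂u‖²` on `D(ℰ)`, by lower semicontinuity of the energy. -/
lemma energy_le_norm_grad_sq (hA : T.IsRegular A) (u : T.dom) :
    T.energy u ≤ ENNReal.ofReal (‖C.grad hA u‖ ^ 2) :=
  iSup_le fun t => ENNReal.ofReal_le_ofReal <|
    C.approx_le_of_mem_graph_closedD (p := (u, C.grad hA u))
      (C.closedD.mem_graph (Submodule.inclusion (C.dom_le hA) u)) t.2

/-- Links the gradient to the quotient `D₀(ℰ)`: solutions with equal gradients have the same class.
-/
lemma mem_ker_of_grad_eq_zero (hA : T.IsRegular A) {u : T.dom} (hu : C.grad hA u = 0) :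
    u ∈ T.ker := by
  have h := C.energy_le_norm_grad_sq hA u
  change T.energy u = 0
  simpa [hu] using h

/-! ### Monotonicity and uniqueness -/

/-- Weak solutions of a strongly monotone equation have the same gradient. -/
lemma grad_sub_eq_zero (hA : T.IsRegular A) {F : H → H} {θ : ℝ} (hθ : 0 < θ)
    (hF : ∀ h v : H, θ * ‖h - v‖ ^ 2 ≤ (inner ℂ (F h - F v) (h - v)).re)
    {f u v : T.dom} (hu : C.IsWeakSolution hA F f u) (hv : C.IsWeakSolution hA F f v) :
    C.grad hA (u - v) = 0 := by
  have h := hF (C.grad hA u) (C.grad hA v)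
  -- Both equations are tested with `g = u - v`; each pairing equals `⟨f, u - v⟩`, so their
  -- difference is zero.
  rw [← map_sub, inner_sub_left, hu (u - v), hv (u - v), sub_self, Complex.zero_re] at h
  have h0 : ‖C.grad hA (u - v)‖ ^ 2 = 0 :=
    le_antisymm (nonpos_of_mul_nonpos_right h hθ) (by positivity)
  simpa using h0

end DirichletCalculus

end NCDirichlet.SymmetricMarkovTriple

theorem mainTheorem4 {N : Type u} [CStarAlgebra N] [PartialOrder N] [StarOrderedRing N]
    [WStarAlgebra N] (T : NCDirichlet.SymmetricMarkovTriple N)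
    (A : NonUnitalStarSubalgebra ℂ N) (hA : T.IsRegular A)
    {H : Type v} [NormedAddCommGroup H] [InnerProductSpace ℂ H] [CompleteSpace H]
    (C : T.DirichletCalculus A H)
    (F : H → H) (θ : ℝ) (hθ : 0 < θ)
    (hF : ∀ h v : H, θ * ‖h - v‖ ^ 2 ≤ (inner ℂ (F h - F v) (h - v)).re)
    (f : T.dom) (U₁ U₂ : T.D0)
    (h₁ : C.IsWeakSolution₀ hA F f U₁) (h₂ : C.IsWeakSolution₀ hA F f U₂) :
    U₁ = U₂ := by
  obtain ⟨u, rfl, hu⟩ := h₁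
  obtain ⟨v, rfl, hv⟩ := h₂
  exact (Submodule.Quotient.eq _).2
    (C.mem_ker_of_grad_eq_zero hA (C.grad_sub_eq_zero hA hθ hF hu hv))
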